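/- **Theorem 3.5.** Let $C_{-1}$ be the set of real- or complex-valued functions $f$ on $(0,\infty)$ of the form $f(x)=x^{p}f_1(x)$ with some real $p>-1$ and $f_1\in C[0,\infty)$. With pointwise addition and the Laplace convolution $(f*g)(x)=\int_0^x f(x-t)g(t)\,dt$ it is a commutative ring without zero divisors; let $M_{-1}$ be its field of convolution quotients $f/g$ ($f,g\in C_{-1}$, $g\neq 0$; $f/g=f_1/g_1$ if and only if $f*g_1=g*f_1$), with multiplication $\circ$ and with scalar multiplication $\lambda (f/g)=(\lambda f)/g$. The ring $C_{-1}$ is embedded in $M_{-1}$ by $f\mapsto (h_\alpha*f)/h_\alpha$, where $h_\alpha(x)=x^{\alpha-1}/\Gamma(\alpha)$, $\alpha>0$ (the class does not depend on $\alpha$). Put $S_\alpha=h_\alpha^{-1}$ and $S_{-\alpha}=h_\alpha$ for $\alpha>0$, and let $S_0$ be the unit of $M_{-1}$. Let $J^{\alpha}f(x)=\frac1{\Gamma(\alpha)}\int_0^x (x-\tau)^{\alpha-1}f(\tau)\,d\tau$ for $\alpha>0$, $J^0f=f$, and $D^{\alpha}=\frac{d}{dx}J^{1-\alpha}$ for $\alpha\in(0,1]$.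 Let $m\ge 1$ be an integer, let $\alpha_0,\dots,\alpha_m\in(0,1]$, and put, for $0\le k\le m$, $$\varrho_k=\sum_{j=0}^{k}\alpha_j-1,\qquad \mathcal D^{\varrho_k}=J^{1-\alpha_k}D^{\alpha_{k-1}}\cdots D^{\alpha_1}D^{\alpha_0}$$ (so $\mathcal D^{\varrho_0}=J^{1-\alpha_0}$). Assume $\varrho_m>0$; then $0<\varrho_m\le m$. Let $y\in\Omega^{\varrho_m}_{-1}$, that is, $y\in C_{-1}$ and for each $k=0,\dots,m-1$ the sequential derivative $D^{\alpha_k}\cdots D^{\alpha_0}y=\frac{d}{dx}\mathcal D^{\varrho_k}y$ exists on $(0,\infty)$ and belongs to $C_{-1}$. Then $\mathcal D^{\varrho_m}y\in C_{-1}$, the limits $(\mathcal D^{\varrho_k}y)(0):=\lim_{x\to0+}(\mathcal D^{\varrho_k}y)(x)$, $0\le k\le m-1$, exist, and in $M_{-1}$ $$\mathcal D^{\varrho_m}y=S_{\varrho_m}\circ y-\sum_{k=0}^{m-1}(\mathcal D^{\varrho_k}y)(0)\,S_{\varrho_m-\varrho_k-1}.$$ -/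

import Mathlib

open MeasureTheory Set Filter Topology
open scoped Convolution

namespace MikusinskiDN

/-- The space `C_γ`: functions `g` with `g(x) = x^p g₁(x)`, `x > 0`, for some real `p > γ` and some
`g₁ ∈ C[0, ∞)`. Only the values on `(0, ∞)` matter. -/
def MemC {𝕜 : Type*} [RCLike 𝕜] (γ : ℝ) (f : ℝ → 𝕜) : Prop :=
  ∃ p : ℝ, γ < p ∧ ∃ g : ℝ → 𝕜, ContinuousOn g (Ici 0) ∧
    ∀ x, 0 < x → f x = ((x ^ p : ℝ) : 𝕜) * g x

theorem MemC.exists_continuous {𝕜 : Type*} [RCLike 𝕜] {γ : ℝ} {f : ℝ → 𝕜} (hf : MemC γ f) :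
    ∃ p : ℝ, γ < p ∧ ∃ g : ℝ → 𝕜, Continuous g ∧ ∀ x, 0 < x → f x = ((x ^ p : ℝ) : 𝕜) * g x := by
  obtain ⟨p, hp, g, hg, h⟩ := hf
  refine ⟨p, hp, fun x => g (max x 0), ?_, fun x hx => ?_⟩
  · exact hg.comp_continuous (by fun_prop) (fun x => le_max_right x 0)
  · simp only [max_eq_left hx.le]
    exact h x hx

theorem MemC.add {𝕜 : Type*} [RCLike 𝕜] {γ : ℝ} {f g : ℝ → 𝕜} (hf : MemC γ f) (hg : MemC γ g) :
    MemC γ (f + g) := by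
  obtain ⟨p, hp, f₁, hf₁, h⟩ := hf
  obtain ⟨q, hq, g₁, hg₁, h'⟩ := hg
  refine ⟨min p q, lt_min hp hq, fun x => ((x ^ (p - min p q) : ℝ) : 𝕜) * f₁ x +
    ((x ^ (q - min p q) : ℝ) : 𝕜) * g₁ x, ?_, fun x hx => ?_⟩
  · refine ContinuousOn.add (ContinuousOn.mul ?_ hf₁) (ContinuousOn.mul ?_ hg₁)
    · exact (RCLike.continuous_ofReal.comp
        (Real.continuous_rpow_const (by simp))).continuousOn
    · exact (RCLike.continuous_ofReal.comp
        (Real.continuous_rpow_const (by simp))).continuousOn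
  · have e1 : x ^ p = x ^ (min p q) * x ^ (p - min p q) := by
      rw [← Real.rpow_add hx]; congr 1; ring
    have e2 : x ^ q = x ^ (min p q) * x ^ (q - min p q) := by
      rw [← Real.rpow_add hx]; congr 1; ring
    simp only [Pi.add_apply]
    rw [h x hx, h' x hx, e1, e2]
    push_cast
    ring

theorem MemC.smul {𝕜 : Type*} [RCLike 𝕜] {γ : ℝ} {f : ℝ → 𝕜} (c : 𝕜) (hf : MemC γ f) :
    MemC γ (c • f) := by
  obtain ⟨p, hp, f₁, hf₁, h⟩ := hf
  refine ⟨p, hp, fun x => c * f₁ x, continuousOn_const.mul hf₁, fun x hx => ?_⟩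
  simp only [Pi.smul_apply, smul_eq_mul, h x hx]
  ring

theorem memC_zero {𝕜 : Type*} [RCLike 𝕜] (γ : ℝ) : MemC γ (0 : ℝ → 𝕜) :=
  ⟨γ + 1, by linarith, 0, continuousOn_const, fun x _ => by simp⟩

/-- The Laplace convolution. -/
noncomputable def conv {𝕜 : Type*} [RCLike 𝕜] (f g : ℝ → 𝕜) (x : ℝ) : 𝕜 :=
  ∫ t in (0 : ℝ)..x, f (x - t) * g t

theorem integrable_beta {p q : ℝ} (hp : -1 < p) (hq : -1 < q) :
    IntervalIntegrable (fun s : ℝ => (1 - s) ^ p * s ^ q) volume 0 1 := by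
  have h := (Complex.betaIntegral_convergent (u := ((q + 1 : ℝ) : ℂ)) (v := ((p + 1 : ℝ) : ℂ))
    (by simpa using by linarith) (by simpa using by linarith)).norm
  refine h.congr_ae ?_
  rw [EventuallyEq, ae_restrict_iff' measurableSet_uIoc]
  have h1 : ∀ᵐ s : ℝ, s ≠ 1 := by simp [ae_iff, measure_singleton]
  filter_upwards [h1] with s hs1 hs
  rw [uIoc_of_le zero_le_one] at hs
  have hs' : 0 < 1 - s := by
    rcases hs.2.lt_or_eq with h | h
    · linarith
    · exact absurd h hs1
  have e1 : (1 - (s : ℂ)) = ((1 - s : ℝ) : ℂ) := by push_cast; rfl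
  rw [norm_mul, e1, Complex.norm_cpow_eq_rpow_re_of_pos hs.1,
    Complex.norm_cpow_eq_rpow_re_of_pos hs']
  simp [mul_comm]

theorem conv_scale {𝕜 : Type*} [RCLike 𝕜] {f g f₁ g₁ : ℝ → 𝕜} {p q : ℝ}
    (hf : ∀ x, 0 < x → f x = ((x ^ p : ℝ) : 𝕜) * f₁ x)
    (hg : ∀ x, 0 < x → g x = ((x ^ q : ℝ) : 𝕜) * g₁ x) {x s : ℝ} (hx : 0 < x)
    (hs0 : 0 < s) (hs1 : s < 1) :
    f (x - x * s) * g (x * s) = ((x ^ (p + q) : ℝ) : 𝕜) *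
      ((((1 - s) ^ p * s ^ q : ℝ) : 𝕜) * (f₁ (x * (1 - s)) * g₁ (x * s))) := by
  have h1 : 0 < 1 - s := by linarith
  have e : x - x * s = x * (1 - s) := by ring
  rw [e, hf _ (mul_pos hx h1), hg _ (mul_pos hx hs0), Real.mul_rpow hx.le h1.le,
    Real.mul_rpow hx.le hs0.le, Real.rpow_add hx]
  push_cast
  ring

theorem ae_mem_Ioo : ∀ᵐ s : ℝ, s ∈ uIoc (0 : ℝ) 1 → 0 < s ∧ s < 1 := by
  have h1 : ∀ᵐ s : ℝ, s ≠ 1 := by simp [ae_iff, measure_singleton]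
  filter_upwards [h1] with s hs1 hs
  rw [uIoc_of_le zero_le_one] at hs
  exact ⟨hs.1, lt_of_le_of_ne hs.2 hs1⟩

theorem integrable_conv {𝕜 : Type*} [RCLike 𝕜] {f g : ℝ → 𝕜} (hf : MemC (-1) f)
    (hg : MemC (-1) g) (x : ℝ) (hx : 0 < x) :
    IntervalIntegrable (fun t => f (x - t) * g t) volume 0 x := by
  obtain ⟨p, hp, f₁, hf₁, hf⟩ := hf.exists_continuous
  obtain ⟨q, hq, g₁, hg₁, hg⟩ := hg.exists_continuous
  have key : IntervalIntegrable (fun s => f (x - x * s) * g (x * s)) volume 0 1 := by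
    have hb : IntervalIntegrable (fun s : ℝ => (((1 - s) ^ p * s ^ q : ℝ) : 𝕜)) volume 0 1 := by
      have := integrable_beta hp hq
      rw [intervalIntegrable_iff] at this ⊢
      exact this.ofReal
    have h2 := (hb.mul_continuousOn (g := fun s => f₁ (x * (1 - s)) * g₁ (x * s))
      (Continuous.continuousOn (by fun_prop))).const_mul ((x ^ (p + q) : ℝ) : 𝕜)
    refine h2.congr_ae ?_
    rw [EventuallyEq, ae_restrict_iff' measurableSet_uIoc]
    filter_upwards [ae_mem_Ioo] with s hs hs'
    obtain ⟨h0, h1⟩ := hs hs'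
    rw [conv_scale hf hg hx h0 h1]
  have := key.comp_mul_left (c := x⁻¹)
  simpa [hx.ne', mul_inv_cancel_left₀] using this

theorem MemC.conv {𝕜 : Type*} [RCLike 𝕜] {f g : ℝ → 𝕜} (hf : MemC (-1) f) (hg : MemC (-1) g) :
    MemC (-1) (conv f g) := by
  obtain ⟨p, hp, f₁, hf₁, hf⟩ := hf.exists_continuous
  obtain ⟨q, hq, g₁, hg₁, hg⟩ := hg.exists_continuous
  refine ⟨p + q + 1, by linarith, fun x => ∫ s in (0 : ℝ)..1,
    (((1 - s) ^ p * s ^ q : ℝ) : 𝕜) * (f₁ (x * (1 - s)) * g₁ (x * s)), ?_, fun x hx => ?_⟩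
  · apply Continuous.continuousOn
    rw [continuous_iff_continuousAt]
    intro x₀
    have hK : IsCompact (Icc (x₀ - 1) (x₀ + 1) ×ˢ Icc (0 : ℝ) 1) := isCompact_Icc.prod isCompact_Icc
    obtain ⟨B, hB⟩ := hK.exists_bound_of_continuousOn
      (f := fun z : ℝ × ℝ => f₁ (z.1 * (1 - z.2)) * g₁ (z.1 * z.2))
      (Continuous.continuousOn (by fun_prop))
    refine intervalIntegral.continuousAt_of_dominated_interval
      (bound := fun s => |(1 - s) ^ p * s ^ q| * B) ?_ ?_ ?_ ?_
    · refine Eventually.of_forall fun x => AEStronglyMeasurable.mul ?_ ?_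
      · have := (integrable_beta hp hq)
        rw [intervalIntegrable_iff] at this
        exact this.ofReal.aestronglyMeasurable
      · exact Continuous.aestronglyMeasurable (by fun_prop)
    · have : Icc (x₀ - 1) (x₀ + 1) ∈ 𝓝 x₀ := Icc_mem_nhds (by linarith) (by linarith)
      filter_upwards [this] with x hx
      refine Eventually.of_forall fun s hs => ?_
      rw [uIoc_of_le zero_le_one] at hs
      rw [norm_mul, RCLike.norm_ofReal]
      exact mul_le_mul_of_nonneg_left (hB (x, s) ⟨hx, hs.1.le, hs.2⟩) (abs_nonneg _)
    · exact (integrable_beta hp hq).abs.mul_const B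
    · refine Eventually.of_forall fun s _ => ?_
      exact Continuous.continuousAt (by fun_prop)
  · have h1 : MikusinskiDN.conv f g x = x • ∫ s in (0 : ℝ)..1, f (x - x * s) * g (x * s) := by
      rw [MikusinskiDN.conv,
        intervalIntegral.smul_integral_comp_mul_left (fun t => f (x - t) * g t) x]
      simp
    rw [h1, intervalIntegral.integral_congr_ae (g := fun s => ((x ^ (p + q) : ℝ) : 𝕜) *
      ((((1 - s) ^ p * s ^ q : ℝ) : 𝕜) * (f₁ (x * (1 - s)) * g₁ (x * s))))
      (ae_mem_Ioo.mono fun s hs hs' => conv_scale hf hg hx (hs hs').1 (hs hs').2),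
      intervalIntegral.integral_const_mul, Real.rpow_add_one hx.ne', RCLike.real_smul_eq_coe_mul]
    push_cast
    ring

/-- The space of functions of class `C_{-1}`, each normalised to vanish outside the
half-line `(0, ∞)` on which it lives. -/
def CSpace (𝕜 : Type*) [RCLike 𝕜] : Submodule 𝕜 (ℝ → 𝕜) where
  carrier := {f | MemC (-1) f ∧ ∀ x ≤ 0, f x = 0}
  add_mem' := fun ha hb => ⟨ha.1.add hb.1, fun x hx => by simp [ha.2 x hx, hb.2 x hx]⟩
  zero_mem' := ⟨memC_zero _, fun _ _ => rfl⟩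
  smul_mem' := fun c _ ha => ⟨ha.1.smul c, fun x hx => by simp [ha.2 x hx]⟩

theorem conv_of_nonpos {𝕜 : Type*} [RCLike 𝕜] {f g : ℝ → 𝕜} (hg : ∀ x ≤ 0, g x = 0) {x : ℝ}
    (hx : x ≤ 0) : conv f g x = 0 := by
  rw [conv, intervalIntegral.integral_congr (g := fun _ => 0)]
  · simp
  · intro t ht
    rw [uIcc_of_ge hx] at ht
    simp [hg t ht.2]

theorem conv_eq_convolution {𝕜 : Type*} [RCLike 𝕜] {f g : ℝ → 𝕜} (hf : ∀ x ≤ 0, f x = 0)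
    (hg : ∀ x ≤ 0, g x = 0) : conv f g = f ⋆[ContinuousLinearMap.mul 𝕜 𝕜, volume] g := by
  ext x
  rw [convolution_mul_swap]
  rcases le_or_gt x 0 with hx | hx
  · rw [conv_of_nonpos hg hx, integral_eq_zero_of_ae (Eventually.of_forall fun t => ?_)]
    rcases le_or_gt t 0 with ht | ht
    · simp [hg t ht]
    · simp [hf (x - t) (by linarith)]
  · rw [conv, intervalIntegral.integral_of_le hx.le]
    refine setIntegral_eq_integral_of_forall_compl_eq_zero fun t ht => ?_
    rcases le_or_gt t 0 with h | h
    · simp [hg t h]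
    · have : x < t := by
        by_contra h'
        exact ht ⟨h, not_lt.mp h'⟩
      simp [hf (x - t) (by linarith)]

theorem convolutionExistsAt {𝕜 : Type*} [RCLike 𝕜] {f g : ℝ → 𝕜} (hf : f ∈ CSpace 𝕜)
    (hg : g ∈ CSpace 𝕜) (x : ℝ) :
    ConvolutionExistsAt f g x (ContinuousLinearMap.mul 𝕜 𝕜) volume := by
  rw [ConvolutionExistsAt]
  rcases le_or_gt x 0 with hx | hx
  · refine (integrable_zero ℝ 𝕜 volume).congr (Eventually.of_forall fun t => ?_)
    rcases le_or_gt t 0 with ht | ht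
    · simp [hf.2 t ht]
    · simp [hg.2 (x - t) (by linarith)]
  · have h := integrable_conv hg.1 hf.1 x hx
    rw [intervalIntegrable_iff, uIoc_of_le hx.le] at h
    rw [← integrableOn_iff_integrable_of_support_subset (s := Ioc 0 x)]
    · exact h.congr (Eventually.of_forall fun t => by simp [mul_comm])
    · intro t ht
      simp only [Function.mem_support, ContinuousLinearMap.mul_apply', ne_eq, mul_eq_zero,
        not_or] at ht
      constructor
      · by_contra h'
        exact ht.1 (hf.2 t (not_lt.mp h'))
      · by_contra h'
        exact ht.2 (hg.2 (x - t) (by linarith [not_le.mp h']))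

theorem norm_mem {𝕜 : Type*} [RCLike 𝕜] {f : ℝ → 𝕜} (hf : f ∈ CSpace 𝕜) :
    (fun x => ‖f x‖) ∈ CSpace ℝ := by
  obtain ⟨⟨p, hp, g, hg, h⟩, h0⟩ := hf
  refine ⟨⟨p, hp, fun x => ‖g x‖, hg.norm, fun x hx => ?_⟩, fun x hx => by simp [h0 x hx]⟩
  have := Real.rpow_nonneg hx.le p
  simp [h x hx, abs_of_nonneg this]

theorem aesm {𝕜 : Type*} [RCLike 𝕜] {f : ℝ → 𝕜} (hf : f ∈ CSpace 𝕜) :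
    AEStronglyMeasurable f volume := by
  obtain ⟨⟨p, hp, g, hg, h⟩, h0⟩ := hf
  have : f = (Ioi (0 : ℝ)).indicator (fun x => ((x ^ p : ℝ) : 𝕜) * g x) := by
    ext x
    by_cases hx : 0 < x
    · simp [hx, h x hx]
    · simp [hx, h0 x (not_lt.mp hx)]
  rw [this, aestronglyMeasurable_indicator_iff measurableSet_Ioi]
  refine AEStronglyMeasurable.mul ?_ ?_
  · exact (RCLike.measurable_ofReal.comp (measurable_id.pow_const p)).aestronglyMeasurable
  · exact (hg.mono Ioi_subset_Ici_self).aestronglyMeasurable measurableSet_Ioi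

theorem conv_mem {𝕜 : Type*} [RCLike 𝕜] {f g : ℝ → 𝕜} (hf : f ∈ CSpace 𝕜) (hg : g ∈ CSpace 𝕜) :
    conv f g ∈ CSpace 𝕜 :=
  ⟨hf.1.conv hg.1, fun _ hx => conv_of_nonpos hg.2 hx⟩

theorem conv_comm {𝕜 : Type*} [RCLike 𝕜] (f g : ℝ → 𝕜) : conv f g = conv g f := by
  ext x
  have := intervalIntegral.integral_comp_sub_left (a := 0) (b := x)
    (fun t => g (x - t) * f t) x
  simp only [sub_sub_cancel, sub_self, sub_zero] at this
  rw [conv, conv, ← this]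
  simp only [mul_comm]

theorem conv_assoc {𝕜 : Type*} [RCLike 𝕜] {f g k : ℝ → 𝕜} (hf : f ∈ CSpace 𝕜)
    (hg : g ∈ CSpace 𝕜) (hk : k ∈ CSpace 𝕜) : conv (conv f g) k = conv f (conv g k) := by
  have hfg := conv_mem hf hg
  have hgk := conv_mem hg hk
  rw [conv_eq_convolution hfg.2 hk.2, conv_eq_convolution hf.2 hgk.2,
    conv_eq_convolution hf.2 hg.2, conv_eq_convolution hg.2 hk.2]
  ext x
  refine convolution_assoc _ _ _ _ (fun a b c => by simp [mul_assoc]) (aesm hf) (aesm hg) (aesm hk)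
    (Eventually.of_forall fun y => convolutionExistsAt hf hg y)
    (Eventually.of_forall fun y => convolutionExistsAt (norm_mem hg) (norm_mem hk) y) ?_
  rw [← conv_eq_convolution (norm_mem hg).2 (norm_mem hk).2]
  exact convolutionExistsAt (norm_mem hf) (conv_mem (norm_mem hg) (norm_mem hk)) x

theorem conv_add {𝕜 : Type*} [RCLike 𝕜] {f g k : ℝ → 𝕜} (hf : f ∈ CSpace 𝕜)
    (hg : g ∈ CSpace 𝕜) (hk : k ∈ CSpace 𝕜) : conv f (g + k) = conv f g + conv f k := by
  rw [conv_eq_convolution hf.2 hg.2, conv_eq_convolution hf.2 hk.2,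
    conv_eq_convolution hf.2 (add_mem hg hk).2]
  ext x
  exact (convolutionExistsAt hf hg x).distrib_add (convolutionExistsAt hf hk x)

theorem smul_conv {𝕜 : Type*} [RCLike 𝕜] (c : 𝕜) (f g : ℝ → 𝕜) :
    conv (c • f) g = c • conv f g := by
  ext x
  simp only [conv, Pi.smul_apply, smul_eq_mul, mul_assoc, intervalIntegral.integral_const_mul]

/-- The ring `(C_{-1}, *, +)`. -/
noncomputable instance instRing {𝕜 : Type*} [RCLike 𝕜] : NonUnitalCommRing (CSpace 𝕜) :=
  { (inferInstance : AddCommGroup (CSpace 𝕜)) with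
    mul := fun f g => ⟨conv f.1 g.1, conv_mem f.2 g.2⟩
    left_distrib := fun f g k => Subtype.ext (conv_add f.2 g.2 k.2)
    right_distrib := fun f g k => Subtype.ext (by
      change conv (f.1 + g.1) k.1 = conv f.1 k.1 + conv g.1 k.1
      rw [conv_comm, conv_add k.2 f.2 g.2, conv_comm k.1, conv_comm k.1])
    zero_mul := fun f => Subtype.ext (by
      change conv 0 f.1 = 0
      ext x
      simp [conv])
    mul_zero := fun f => Subtype.ext (by
      change conv f.1 0 = 0
      ext x
      simp [conv])
    mul_assoc := fun f g k => Subtype.ext (conv_assoc f.2 g.2 k.2)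
    mul_comm := fun f g => Subtype.ext (conv_comm f.1 g.1) }

theorem coe_mul_conv {𝕜 : Type*} [RCLike 𝕜] (f g : CSpace 𝕜) :
    ((f * g : CSpace 𝕜) : ℝ → 𝕜) = conv f.1 g.1 := rfl



theorem eq_zero_of_exp_bounded {g : ℝ → ℂ} (hg : Continuous g) {T : ℝ} (hT : 0 < T) {N : ℝ}
    (hN : ∀ l : ℝ, 0 ≤ l → ‖∫ u in (0 : ℝ)..T, Complex.exp (l * u) * g u‖ ≤ N) :
    ∀ u, 0 < u → u < T → g u = 0 := by
  obtain ⟨A, hA⟩ := (isCompact_Icc (a := (0 : ℝ)) (b := T)).exists_bound_of_continuousOn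
    hg.continuousOn
  have hA0 : 0 ≤ A := (norm_nonneg _).trans (hA 0 ⟨le_rfl, hT.le⟩)
  set F : ℂ → ℂ := fun z => ∫ u in (0 : ℝ)..T, Complex.exp (z * u) * g u with hF
  have hnorm : ∀ (z : ℂ) (B : ℝ), (∀ u ∈ Icc 0 T, z.re * u ≤ B) → ‖F z‖ ≤ Real.exp B * A * T := by
    intro z B hB
    have := intervalIntegral.norm_integral_le_of_norm_le_const (a := 0) (b := T)
      (C := Real.exp B * A) (f := fun u : ℝ => Complex.exp (z * u) * g u) (fun u hu => by
        rw [uIoc_of_le hT.le] at hu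
        rw [norm_mul, Complex.norm_exp]
        refine mul_le_mul (Real.exp_le_exp.mpr ?_) (hA u ⟨hu.1.le, hu.2⟩) (norm_nonneg _)
          (Real.exp_pos _).le
        simpa using hB u ⟨hu.1.le, hu.2⟩)
    simpa [abs_of_pos hT] using this
  have hdiff : Differentiable ℂ F := by
    intro z₀
    have := intervalIntegral.hasDerivAt_integral_of_dominated_loc_of_deriv_le (μ := volume)
      (a := 0) (b := T) (x₀ := z₀) (s := Metric.ball z₀ 1)
      (F := fun z (u : ℝ) => Complex.exp (z * u) * g u)
      (F' := fun z (u : ℝ) => (Complex.exp (z * u) * u) * g u)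
      (bound := fun _ => (Real.exp ((‖z₀‖ + 1) * T) * T) * A)
      (Metric.ball_mem_nhds _ one_pos)
      (Eventually.of_forall fun z => Continuous.aestronglyMeasurable (by fun_prop))
      (Continuous.intervalIntegrable (by fun_prop) _ _)
      (Continuous.aestronglyMeasurable (by fun_prop))
      (Eventually.of_forall fun u hu z hz => by
        rw [uIoc_of_le hT.le] at hu
        rw [norm_mul, norm_mul, Complex.norm_exp]
        have h1 : (z * (u : ℂ)).re ≤ (‖z₀‖ + 1) * T := by
          have hz' : ‖z‖ ≤ ‖z₀‖ + 1 := by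
            have := norm_sub_norm_le z z₀
            rw [Metric.mem_ball, dist_eq_norm] at hz
            linarith
          calc (z * (u : ℂ)).re ≤ ‖z * (u : ℂ)‖ := Complex.re_le_norm _
            _ = ‖z‖ * u := by simp [abs_of_pos hu.1]
            _ ≤ (‖z₀‖ + 1) * T := mul_le_mul hz' hu.2 hu.1.le (by positivity)
        have h2 : ‖(u : ℂ)‖ ≤ T := by simpa [abs_of_pos hu.1] using hu.2
        gcongr
        exact hA u ⟨hu.1.le, hu.2⟩)
      intervalIntegrable_const
      (Eventually.of_forall fun u _ z _ => by
        have h := ((hasDerivAt_id z).mul_const (u : ℂ)).cexp.mul_const (g u)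
        simpa using h)
    exact this.2.differentiableAt
  have hleft : ∀ z : ℂ, z.re ≤ 0 → ‖F z‖ ≤ A * T := by
    intro z hz
    simpa using hnorm z 0 (fun u hu => mul_nonpos_of_nonpos_of_nonneg hz hu.1)
  have hright : ∀ z : ℂ, 0 ≤ z.re → ‖F z‖ ≤ A * T := by
    intro z hz
    refine PhragmenLindelof.right_half_plane_of_bounded_on_real hdiff.diffContOnCl
      ⟨1, by norm_num, T, ?_⟩ ?_ (fun x => hleft _ (by simp)) hz
    · refine Asymptotics.IsBigO.of_bound (A * T) (Eventually.of_forall fun z => ?_)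
      have := hnorm z (T * ‖z‖ ^ (1 : ℝ)) (fun u hu => by
        rw [Real.rpow_one]
        calc z.re * u ≤ ‖z‖ * T :=
              mul_le_mul (Complex.re_le_norm z) hu.2 hu.1 (norm_nonneg _)
          _ = T * ‖z‖ := mul_comm _ _)
      rw [Real.norm_of_nonneg (Real.exp_pos _).le]
      linarith
    · refine ⟨N, ?_⟩
      rw [eventually_map]
      filter_upwards [eventually_ge_atTop 0] with x hx
      exact hN x hx
  have hbdd : Bornology.IsBounded (range F) := by
    rw [isBounded_iff_forall_norm_le]
    refine ⟨A * T, ?_⟩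
    rintro _ ⟨z, rfl⟩
    exact (le_total z.re 0).elim (hleft z) (hright z)
  have hconst : ∀ z, F z = F 0 := fun z => hdiff.apply_eq_apply_of_bounded hbdd z 0
  set G : ℝ → ℂ := (Ioc (0 : ℝ) T).indicator g with hG
  have hfour : ∀ w : ℝ, FourierTransform.fourier G w = F 0 := by
    intro w
    rw [Real.fourier_real_eq_integral_exp_smul, ← hconst (-2 * Real.pi * w * Complex.I), hF]
    simp only
    rw [intervalIntegral.integral_of_le hT.le, ← integral_indicator measurableSet_Ioc]
    congr 1
    ext v
    by_cases hv : v ∈ Ioc 0 T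
    · simp only [hG, indicator_of_mem hv, smul_eq_mul]
      congr 2
      push_cast
      ring
    · simp [hG, indicator_of_notMem hv]
  have h0 : F 0 = 0 := by
    have h1 := Real.zero_at_infty_fourier G
    have h2 : (FourierTransform.fourier G : ℝ → ℂ) = fun _ => F 0 := funext hfour
    rw [h2] at h1
    exact tendsto_nhds_unique tendsto_const_nhds h1
  have hz : (FourierTransform.fourier G : ℝ → ℂ) = 0 := by
    funext w
    rw [hfour, h0]
    rfl
  intro u hu hu'
  have hGi : Integrable G := by
    rw [hG, integrable_indicator_iff measurableSet_Ioc]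
    exact (hg.continuousOn.integrableOn_Icc).mono_set Ioc_subset_Icc_self
  have hmem : Ioc (0 : ℝ) T ∈ 𝓝 u := Ioc_mem_nhds hu hu'
  have hc : ContinuousAt G u := by
    refine hg.continuousAt.congr ?_
    filter_upwards [hmem] with v hv
    simp [hG, indicator_of_mem hv]
  have := hGi.fourierInv_fourier_eq (by rw [hz]; exact integrable_zero _ _ _) hc
  rw [hz] at this
  have h3 : G u = g u := by simp [hG, hu, hu'.le]
  rw [← h3, ← this, Real.fourierInv_eq]
  simp

theorem eq_zero_of_moments {g : ℝ → ℂ} (hg : Continuous g) {T : ℝ} (hT : 0 < T)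
    (h : ∀ n : ℕ, ∫ u in (0 : ℝ)..T, (u : ℂ) ^ n * g u = 0) :
    ∀ u, 0 < u → u < T → g u = 0 := by
  refine eq_zero_of_exp_bounded hg hT (N := 0) fun l hl => ?_
  obtain ⟨A, hA⟩ := (isCompact_Icc (a := (0 : ℝ)) (b := T)).exists_bound_of_continuousOn
    hg.continuousOn
  have hs : HasSum (fun n : ℕ => ∫ u in (0 : ℝ)..T, ((n.factorial : ℂ)⁻¹ * (l * u) ^ n) * g u)
      (∫ u in (0 : ℝ)..T, Complex.exp (l * u) * g u) := by
    refine intervalIntegral.hasSum_integral_of_dominated_convergence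
      (bound := fun n _ => ((n.factorial : ℝ)⁻¹ * (l * T) ^ n) * A) ?_ ?_ ?_ ?_ ?_
    · exact fun n => Continuous.aestronglyMeasurable (by fun_prop)
    · refine fun n => Eventually.of_forall fun u hu => ?_
      rw [uIoc_of_le hT.le] at hu
      have h1 : ‖(l : ℂ) * (u : ℂ)‖ ≤ l * T := by
        simp only [norm_mul, Complex.norm_real, Real.norm_of_nonneg hl, Real.norm_of_nonneg hu.1.le]
        exact mul_le_mul_of_nonneg_left hu.2 hl
      rw [norm_mul, norm_mul, norm_pow, norm_inv, Complex.norm_natCast]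
      have h2 := hA u ⟨hu.1.le, hu.2⟩
      gcongr
    · refine Eventually.of_forall fun u _ => Summable.mul_right _ ?_
      have := Real.summable_pow_div_factorial (l * T)
      simpa [div_eq_inv_mul] using this
    · exact intervalIntegrable_const
    · refine Eventually.of_forall fun u _ => HasSum.mul_right _ ?_
      have := NormedSpace.expSeries_div_hasSum_exp ((l : ℂ) * u)
      rw [← Complex.exp_eq_exp_ℂ] at this
      simpa [div_eq_inv_mul] using this
  have hz : ∀ n : ℕ, ∫ u in (0 : ℝ)..T, ((n.factorial : ℂ)⁻¹ * (l * u) ^ n) * g u = 0 := by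
    intro n
    have : ∀ u : ℝ, ((n.factorial : ℂ)⁻¹ * (l * u) ^ n) * g u
        = ((n.factorial : ℂ)⁻¹ * l ^ n) * ((u : ℂ) ^ n * g u) := fun u => by ring
    simp only [this, intervalIntegral.integral_const_mul, h n, mul_zero]
  simp only [hz] at hs
  rw [hs.unique hasSum_zero]
  simp

theorem sq_eq_zero {f : ℝ → ℂ} (hf : Continuous f)
    (h : ∀ x, 0 ≤ x → ∫ t in (0 : ℝ)..x, f (x - t) * f t = 0) : ∀ x, 0 < x → f x = 0 := by
  intro X hX
  suffices H : ∀ u, 0 < u → u < 2 * X → f (2 * X - u) = 0 by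
    have := H X hX (by linarith)
    rwa [show 2 * X - X = X by ring] at this
  generalize hTX : 2 * X = T
  have hT : 0 < T := by linarith
  obtain ⟨A, hA⟩ := (isCompact_Icc (a := (0 : ℝ)) (b := 2 * T)).exists_bound_of_continuousOn
    hf.continuousOn
  have hA0 : 0 ≤ A := (norm_nonneg _).trans (hA 0 ⟨le_rfl, by linarith⟩)
  refine eq_zero_of_exp_bounded (g := fun u => f (T - u)) (by fun_prop) hT
    (N := 2 * T * A + T * A) fun l hl => ?_
  set e : ℝ → ℂ := fun s => Complex.exp (-(l * s : ℝ)) * f s with he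
  have hec : Continuous e := by fun_prop
  set φ : ℝ → ℂ := (Icc (0 : ℝ) (2 * T)).indicator e with hφ
  have hφi : Integrable φ := by
    rw [hφ, integrable_indicator_iff measurableSet_Icc]
    exact hec.continuousOn.integrableOn_Icc
  have hprod : ∀ t x : ℝ, e t * e (x - t) = Complex.exp (-(l * x : ℝ)) * (f (x - t) * f t) := by
    intro t x
    simp only [he]
    have : Complex.exp (-(l * x : ℝ)) = Complex.exp (-(l * t : ℝ)) * Complex.exp (-(l * (x - t) : ℝ)) := by
      rw [← Complex.exp_add]
      congr 1
      push_cast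
      ring
    rw [this]
    ring
  have hconv : ∀ x, ‖(φ ⋆[ContinuousLinearMap.mul ℂ ℂ, volume] φ) x‖ ≤
      (Icc (2 * T) (4 * T)).indicator (fun _ => Real.exp (-(2 * l * T)) * A ^ 2 * (2 * T)) x := by
    intro x
    rw [convolution_def]
    simp only [ContinuousLinearMap.mul_apply']
    by_cases hx : x ∈ Ioc (2 * T) (4 * T)
    · rw [indicator_of_mem (Ioc_subset_Icc_self hx)]
      have h1 : ∀ t, ‖φ t * φ (x - t)‖ ≤ (Icc (0 : ℝ) (2 * T)).indicator
          (fun _ => Real.exp (-(2 * l * T)) * A ^ 2) t := by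
        intro t
        by_cases ht : t ∈ Icc (0 : ℝ) (2 * T)
        · rw [indicator_of_mem ht]
          by_cases ht' : x - t ∈ Icc (0 : ℝ) (2 * T)
          · rw [hφ, indicator_of_mem ht, indicator_of_mem ht', hprod, norm_mul, norm_mul,
              ← Complex.ofReal_neg, ← Complex.ofReal_exp, Complex.norm_real,
              Real.norm_of_nonneg (Real.exp_pos _).le, pow_two]
            refine mul_le_mul (Real.exp_le_exp.mpr ?_) (mul_le_mul (hA _ ht') (hA _ ht)
              (norm_nonneg _) hA0) (by positivity) (Real.exp_pos _).le
            nlinarith [hx.1]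
          · rw [hφ, indicator_of_notMem ht', mul_zero, norm_zero]
            positivity
        · rw [indicator_of_notMem ht, hφ, indicator_of_notMem ht, zero_mul, norm_zero]
      refine (norm_integral_le_of_norm_le ?_ (Eventually.of_forall h1)).trans ?_
      · rw [integrable_indicator_iff measurableSet_Icc]
        exact integrableOn_const (by rw [Real.volume_Icc]; exact ENNReal.ofReal_ne_top)
      · rw [integral_indicator measurableSet_Icc, setIntegral_const]
        simp only [Measure.real, Real.volume_Icc, sub_zero]
        rw [ENNReal.toReal_ofReal (by linarith), smul_eq_mul]
        linarith
    · refine le_trans (le_of_eq ?_) (indicator_nonneg (fun _ _ => by positivity) x)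
      rw [norm_eq_zero]
      by_cases hx2 : x ∈ Icc 0 (2 * T)
      · have : ∀ t, φ t * φ (x - t) = (Icc (0 : ℝ) x).indicator
            (fun t => Complex.exp (-(l * x : ℝ)) * (f (x - t) * f t)) t := by
          intro t
          by_cases ht : t ∈ Icc 0 x
          · have h1 : t ∈ Icc (0 : ℝ) (2 * T) := ⟨ht.1, ht.2.trans hx2.2⟩
            have h2 : x - t ∈ Icc (0 : ℝ) (2 * T) := ⟨by linarith [ht.2], by linarith [ht.1, hx2.2]⟩
            rw [indicator_of_mem ht, hφ, indicator_of_mem h1, indicator_of_mem h2, hprod]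
          · rw [indicator_of_notMem ht]
            by_cases h1 : t ∈ Icc (0 : ℝ) (2 * T)
            · have h2 : x - t ∉ Icc (0 : ℝ) (2 * T) := fun h2 => ht ⟨h1.1, by linarith [h2.1]⟩
              rw [hφ, indicator_of_notMem h2, mul_zero]
            · rw [hφ, indicator_of_notMem h1, zero_mul]
        simp only [this]
        rw [integral_indicator measurableSet_Icc, integral_Icc_eq_integral_Ioc,
          ← intervalIntegral.integral_of_le hx2.1, intervalIntegral.integral_const_mul, h x hx2.1,
          mul_zero]
      · refine integral_eq_zero_of_ae (Eventually.of_forall fun t => ?_)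
        simp only [Pi.zero_apply]
        by_cases h1 : t ∈ Icc (0 : ℝ) (2 * T)
        · have h2 : x - t ∉ Icc (0 : ℝ) (2 * T) := by
            intro h2
            rcases le_or_gt x (2 * T) with h3 | h3
            · exact hx2 ⟨by linarith [h1.1, h2.1], h3⟩
            · exact hx ⟨h3, by linarith [h1.2, h2.2]⟩
          rw [hφ, indicator_of_notMem h2, mul_zero]
        · rw [hφ, indicator_of_notMem h1, zero_mul]
  have hsq : ‖∫ s, φ s‖ ^ 2 ≤ (Real.exp (-(l * T)) * (2 * T * A)) ^ 2 := by
    have h1 := integral_convolution (μ := volume) (ν := volume) (ContinuousLinearMap.mul ℂ ℂ)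
      hφi hφi
    rw [ContinuousLinearMap.mul_apply'] at h1
    rw [pow_two, ← norm_mul, ← h1]
    refine (norm_integral_le_of_norm_le ?_ (Eventually.of_forall hconv)).trans ?_
    · rw [integrable_indicator_iff measurableSet_Icc]
      exact integrableOn_const (by rw [Real.volume_Icc]; exact ENNReal.ofReal_ne_top)
    · rw [integral_indicator measurableSet_Icc, setIntegral_const]
      simp only [Measure.real, Real.volume_Icc]
      rw [ENNReal.toReal_ofReal (by linarith), smul_eq_mul]
      have : Real.exp (-(2 * l * T)) = Real.exp (-(l * T)) ^ 2 := by
        rw [← Real.exp_nat_mul]; congr 1; push_cast; ring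
      rw [this]
      exact le_of_eq (by ring)
  have hE : ‖∫ s, φ s‖ ≤ Real.exp (-(l * T)) * (2 * T * A) :=
    (pow_le_pow_iff_left₀ (norm_nonneg _) (by positivity) two_ne_zero).mp hsq
  have hE' : ∫ s, φ s = (∫ s in (0 : ℝ)..T, e s) + ∫ s in T..(2 * T), e s := by
    rw [intervalIntegral.integral_add_adjacent_intervals (hec.intervalIntegrable _ _)
      (hec.intervalIntegrable _ _), hφ, integral_indicator measurableSet_Icc,
      integral_Icc_eq_integral_Ioc, intervalIntegral.integral_of_le (by linarith)]
  have htail : ‖∫ s in T..(2 * T), Complex.exp ((l * T : ℝ)) * e s‖ ≤ T * A := by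
    have := intervalIntegral.norm_integral_le_of_norm_le_const (a := T) (b := 2 * T)
      (C := A) (f := fun s : ℝ => Complex.exp ((l * T : ℝ)) * e s) (fun s hs => by
        rw [uIoc_of_le (by linarith)] at hs
        simp only [he]
        rw [← mul_assoc, ← Complex.exp_add, norm_mul, Complex.norm_exp]
        have h1 : ((((l * T : ℝ)) : ℂ) + -(((l * s : ℝ)) : ℂ)).re ≤ 0 := by
          rw [← Complex.ofReal_neg, ← Complex.ofReal_add, Complex.ofReal_re]
          nlinarith [hs.1]
        calc _ ≤ 1 * A := mul_le_mul (Real.exp_le_one_iff.mpr h1)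
              (hA s ⟨by linarith [hs.1], hs.2⟩) (norm_nonneg _) zero_le_one
          _ = A := one_mul A)
    rw [show 2 * T - T = T by ring, abs_of_pos hT] at this
    linarith
  have hmain : ∫ u in (0 : ℝ)..T, Complex.exp (l * u) * f (T - u)
      = Complex.exp ((l * T : ℝ)) * (∫ s, φ s)
        - ∫ s in T..(2 * T), Complex.exp ((l * T : ℝ)) * e s := by
    rw [hE', intervalIntegral.integral_const_mul, mul_add, add_sub_cancel_right,
      ← intervalIntegral.integral_const_mul]
    have := intervalIntegral.integral_comp_sub_left (a := 0) (b := T)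
      (fun s => Complex.exp ((l * T : ℝ)) * e s) T
    rw [sub_zero, sub_self] at this
    rw [← this]
    congr 1
    ext u
    simp only [he]
    rw [← mul_assoc, ← Complex.exp_add]
    congr 2
    push_cast
    ring
  rw [hmain]
  refine (norm_sub_le _ _).trans (add_le_add ?_ htail)
  rw [norm_mul, Complex.norm_exp, Complex.ofReal_re]
  calc Real.exp (l * T) * ‖∫ s, φ s‖ ≤ Real.exp (l * T) * (Real.exp (-(l * T)) * (2 * T * A)) :=
        mul_le_mul_of_nonneg_left hE (Real.exp_pos _).le
    _ = 2 * T * A := by rw [← mul_assoc, ← Real.exp_add, add_neg_cancel, Real.exp_zero, one_mul]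

theorem memC_const {𝕜 : Type*} [RCLike 𝕜] (c : 𝕜) : MemC (-1) (fun _ : ℝ => c) :=
  ⟨0, by norm_num, fun _ => c, continuousOn_const, fun x _ => by simp⟩

/-- The element of the ring given by a function of class `C_{-1}`. -/
noncomputable def toC {𝕜 : Type*} [RCLike 𝕜] (f : ℝ → 𝕜) (hf : MemC (-1) f) : CSpace 𝕜 :=
  ⟨(Ioi (0 : ℝ)).indicator f, by
    obtain ⟨p, hp, g, hg, h⟩ := hf
    exact ⟨p, hp, g, hg, fun x hx => by rw [indicator_of_mem (mem_Ioi.mpr hx)]; exact h x hx⟩,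
    fun x hx => indicator_of_notMem (by simpa using hx) f⟩

/-- The kernel `h_α(x) = x^{α-1} / Γ(α)`, `α > 0`. -/
noncomputable def hker {𝕜 : Type*} [RCLike 𝕜] (α : ℝ) (hα : 0 < α) : CSpace 𝕜 :=
  toC (fun x => ((x ^ (α - 1) / Real.Gamma α : ℝ) : 𝕜))
    ⟨α - 1, by linarith, fun _ => (((Real.Gamma α)⁻¹ : ℝ) : 𝕜), continuousOn_const,
      fun x _ => by simp [div_eq_mul_inv]⟩

theorem intervalIntegrable_of_mem {𝕜 : Type*} [RCLike 𝕜] {f : ℝ → 𝕜} (hf : f ∈ CSpace 𝕜)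
    (a b : ℝ) : IntervalIntegrable f volume a b := by
  have h : ∀ x, IntervalIntegrable f volume 0 x := by
    intro x
    rcases le_or_gt x 0 with hx | hx
    · refine IntervalIntegrable.congr (f := fun _ => (0 : 𝕜)) (fun t ht => ?_)
        intervalIntegrable_const
      rw [uIoc_of_ge hx] at ht
      exact (hf.2 t ht.2).symm
    · simpa using integrable_conv (memC_const (1 : 𝕜)) hf.1 x hx
  exact (h a).symm.trans (h b)

theorem hker_one_mul {𝕜 : Type*} [RCLike 𝕜] (f : CSpace 𝕜) (x : ℝ) :
    (hker 1 one_pos * f : CSpace 𝕜).1 x = ∫ t in (0 : ℝ)..x, f.1 t := by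
  rw [coe_mul_conv, conv]
  refine intervalIntegral.integral_congr_ae ?_
  have h1 : ∀ᵐ s : ℝ, s ≠ x := by simp [ae_iff, measure_singleton]
  filter_upwards [h1] with t ht ht'
  rcases le_or_gt x 0 with hx | hx
  · rw [uIoc_of_ge hx] at ht'
    simp [f.2.2 t ht'.2]
  · rw [uIoc_of_le hx.le] at ht'
    have : 0 < x - t := by
      have := lt_of_le_of_ne ht'.2 ht
      linarith
    simp [hker, toC, this]

theorem continuous_hker_one_mul {𝕜 : Type*} [RCLike 𝕜] (f : CSpace 𝕜) :
    Continuous (hker 1 one_pos * f : CSpace 𝕜).1 := by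
  rw [show (hker 1 one_pos * f : CSpace 𝕜).1 = fun x => ∫ t in (0 : ℝ)..x, f.1 t from
    funext (hker_one_mul f)]
  exact intervalIntegral.continuous_primitive (intervalIntegrable_of_mem f.2) 0

theorem eq_zero_of_hker_one_mul {𝕜 : Type*} [RCLike 𝕜] {f : CSpace 𝕜}
    (h : hker 1 one_pos * f = 0) : f = 0 := by
  have h0 : ∀ x, ∫ t in (0 : ℝ)..x, f.1 t = 0 := fun x => by
    rw [← hker_one_mul, h]; rfl
  apply Subtype.ext
  funext x
  rcases le_or_gt x 0 with hx | hx
  · exact f.2.2 x hx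
  obtain ⟨p, hp, g, hg, hfg⟩ := f.2.1.exists_continuous
  have hc : ContinuousAt f.1 x := by
    have : ContinuousAt (fun x => ((x ^ p : ℝ) : 𝕜) * g x) x :=
      (RCLike.continuous_ofReal.continuousAt.comp
        (Real.continuousAt_rpow_const x p (Or.inl hx.ne'))).mul hg.continuousAt
    refine this.congr ?_
    filter_upwards [Ioi_mem_nhds hx] with y hy
    exact (hfg y hy).symm
  have hd := intervalIntegral.integral_hasDerivAt_right (intervalIntegrable_of_mem f.2 0 x)
    ⟨univ, univ_mem, (aesm f.2).restrict⟩ hc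
  simp only [h0] at hd
  exact hd.unique (hasDerivAt_const x 0)

theorem rclike_map_mul {𝕜 : Type*} [RCLike 𝕜] (a b : 𝕜) :
    RCLike.map 𝕜 ℂ (a * b) = RCLike.map 𝕜 ℂ a * RCLike.map 𝕜 ℂ b := by
  apply Complex.ext <;> simp [RCLike.mul_re, RCLike.mul_im]

theorem rclike_map_eq_zero {𝕜 : Type*} [RCLike 𝕜] {a : 𝕜} (h : RCLike.map 𝕜 ℂ a = 0) : a = 0 := by
  have h1 := congrArg Complex.re h
  have h2 := congrArg Complex.im h
  simp at h1 h2
  exact RCLike.ext (by simpa using h1) (by simpa using h2)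

theorem rclike_map_integral {𝕜 : Type*} [RCLike 𝕜] (u v : ℝ → 𝕜) (x : ℝ)
    (h : IntervalIntegrable (fun t => u t * v t) volume 0 x) :
    ∫ t in (0 : ℝ)..x, RCLike.map 𝕜 ℂ (u t) * RCLike.map 𝕜 ℂ (v t) =
      RCLike.map 𝕜 ℂ (∫ t in (0 : ℝ)..x, u t * v t) := by
  rw [← ContinuousLinearMap.intervalIntegral_comp_comm _ h]
  simp only [rclike_map_mul]

theorem eq_zero_of_mul_self {𝕜 : Type*} [RCLike 𝕜] {f : CSpace 𝕜} (h : f * f = 0) : f = 0 := by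
  apply eq_zero_of_hker_one_mul
  set F : CSpace 𝕜 := hker 1 one_pos * f with hF
  have hFc : Continuous F.1 := continuous_hker_one_mul f
  have hFF : F * F = 0 := by
    rw [hF, mul_mul_mul_comm, h, mul_zero]
  have key := sq_eq_zero (f := fun x => RCLike.map 𝕜 ℂ (F.1 x)) (by fun_prop) (fun x _ => by
    rw [rclike_map_integral (fun t => F.1 (x - t)) F.1 x
      (Continuous.intervalIntegrable (by fun_prop) _ _)]
    have : ∫ t in (0 : ℝ)..x, F.1 (x - t) * F.1 t = (F * F : CSpace 𝕜).1 x := rfl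
    rw [this, hFF]
    simp)
  apply Subtype.ext
  funext x
  rcases le_or_gt x 0 with hx | hx
  · exact F.2.2 x hx
  · exact rclike_map_eq_zero (key x hx)

/-- Multiplication of a function by its variable, a derivation of the convolution ring. -/
noncomputable def mulVar {𝕜 : Type*} [RCLike 𝕜] (f : CSpace 𝕜) : CSpace 𝕜 :=
  ⟨fun x => (x : 𝕜) * f.1 x, by
    obtain ⟨p, hp, g, hg, h⟩ := f.2.1
    refine ⟨⟨p, hp, fun x => (x : 𝕜) * g x, RCLike.continuous_ofReal.continuousOn.mul hg,
      fun x hx => ?_⟩, fun x hx => by simp [f.2.2 x hx]⟩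
    simp only [h x hx]
    ring⟩

theorem mulVar_mul {𝕜 : Type*} [RCLike 𝕜] (f g : CSpace 𝕜) :
    mulVar (f * g) = mulVar f * g + f * mulVar g := by
  apply Subtype.ext
  funext x
  change (x : 𝕜) * conv f.1 g.1 x = conv (mulVar f).1 g.1 x + conv f.1 (mulVar g).1 x
  rcases le_or_gt x 0 with hx | hx
  · rw [conv_of_nonpos g.2.2 hx, conv_of_nonpos g.2.2 hx, conv_of_nonpos (mulVar g).2.2 hx]
    simp
  · rw [conv, conv, conv, ← intervalIntegral.integral_const_mul,
      ← intervalIntegral.integral_add (integrable_conv (mulVar f).2.1 g.2.1 x hx)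
        (integrable_conv f.2.1 (mulVar g).2.1 x hx)]
    congr 1
    funext t
    simp only [mulVar]
    push_cast
    ring

theorem mul_mulVar_eq_zero {𝕜 : Type*} [RCLike 𝕜] {f g : CSpace 𝕜} (h : f * g = 0) :
    f * mulVar g = 0 := by
  have h1 : mulVar f * g + f * mulVar g = 0 := by
    rw [← mulVar_mul, h]
    apply Subtype.ext
    funext x
    simp [mulVar]
  apply eq_zero_of_mul_self
  have h2 : f * mulVar g = -(mulVar f * g) := (neg_eq_of_add_eq_zero_right h1).symm
  calc f * mulVar g * (f * mulVar g) = -(mulVar f * g) * (f * mulVar g) := by rw [← h2]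
    _ = -((mulVar f * mulVar g) * (f * g)) := by
      rw [neg_mul]
      congr 1
      simp only [mul_comm, mul_left_comm]
    _ = 0 := by rw [h, mul_zero, neg_zero]

theorem mul_iterate_mulVar_eq_zero {𝕜 : Type*} [RCLike 𝕜] {f g : CSpace 𝕜} (h : f * g = 0)
    (n : ℕ) : f * (mulVar^[n] g) = 0 := by
  induction n with
  | zero => exact h
  | succ n ih =>
    rw [Function.iterate_succ_apply']
    exact mul_mulVar_eq_zero ih

theorem iterate_mulVar_apply {𝕜 : Type*} [RCLike 𝕜] (g : CSpace 𝕜) (n : ℕ) (x : ℝ) :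
    (mulVar^[n] g).1 x = (x : 𝕜) ^ n * g.1 x := by
  induction n with
  | zero => simp
  | succ n ih =>
    rw [Function.iterate_succ_apply']
    change (x : 𝕜) * (mulVar^[n] g).1 x = _
    rw [ih]
    ring

/-- The convolution ring has no divisors of zero (Titchmarsh's convolution theorem). -/
theorem eq_zero_or_eq_zero_of_mul {𝕜 : Type*} [RCLike 𝕜] {f g : CSpace 𝕜} (h : f * g = 0) :
    f = 0 ∨ g = 0 := by
  set F : CSpace 𝕜 := hker 1 one_pos * f with hF
  set G : CSpace 𝕜 := hker 1 one_pos * g with hG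
  have hFc : Continuous F.1 := continuous_hker_one_mul f
  have hGc : Continuous G.1 := continuous_hker_one_mul g
  have hFG : F * G = 0 := by rw [hF, hG, mul_mul_mul_comm, h, mul_zero]
  have key : ∀ x, 0 < x → ∀ t, 0 < t → t < x → F.1 (x - t) * G.1 t = 0 := by
    intro x hx t ht htx
    have hmom := eq_zero_of_moments
      (g := fun t => RCLike.map 𝕜 ℂ (F.1 (x - t)) * RCLike.map 𝕜 ℂ (G.1 t)) (by fun_prop) hx
      (fun n => by
        have h1 : (F * (mulVar^[n] G) : CSpace 𝕜).1 x = 0 := by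
          rw [mul_iterate_mulVar_eq_zero hFG n]; rfl
        rw [coe_mul_conv, conv] at h1
        simp only [iterate_mulVar_apply] at h1
        have h2 := rclike_map_integral (fun t => F.1 (x - t)) (fun t => (t : 𝕜) ^ n * G.1 t) x
          (Continuous.intervalIntegrable (by fun_prop) _ _)
        rw [h1, map_zero] at h2
        rw [← h2]
        congr 1
        funext u
        have h3 : RCLike.map 𝕜 ℂ ((u : 𝕜) ^ n * G.1 u) = (u : ℂ) ^ n * RCLike.map 𝕜 ℂ (G.1 u) := by
          have : (u : 𝕜) ^ n * G.1 u = (u ^ n : ℝ) • G.1 u := by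
            rw [RCLike.real_smul_eq_coe_mul]; push_cast; rfl
          rw [this, map_smul, Complex.real_smul]
          push_cast
          rfl
        rw [h3]
        ring) t ht htx
    simp only [← rclike_map_mul] at hmom
    exact rclike_map_eq_zero hmom
  by_cases hG0 : ∃ t, 0 < t ∧ G.1 t ≠ 0
  · obtain ⟨t, ht, hGt⟩ := hG0
    left
    apply eq_zero_of_hker_one_mul
    apply Subtype.ext
    funext s
    rcases le_or_gt s 0 with hs | hs
    · exact F.2.2 s hs
    · have := key (s + t) (by linarith) t ht (by linarith)
      rw [add_sub_cancel_right] at this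
      exact (mul_eq_zero.mp this).resolve_right hGt
  · push Not at hG0
    right
    apply eq_zero_of_hker_one_mul
    apply Subtype.ext
    funext s
    rcases le_or_gt s 0 with hs | hs
    · exact G.2.2 s hs
    · exact hG0 s hs

theorem hker_ne_zero {𝕜 : Type*} [RCLike 𝕜] (α : ℝ) (hα : 0 < α) : (hker α hα : CSpace 𝕜) ≠ 0 := by
  intro h
  have h1 : (hker α hα : CSpace 𝕜).1 1 = 0 := by rw [h]; rfl
  have h2 := (Real.Gamma_pos_of_pos hα).ne'
  simp [hker, toC, h2] at h1

theorem mul_ne_zero_of_ne {𝕜 : Type*} [RCLike 𝕜] {f g : CSpace 𝕜} (hf : f ≠ 0) (hg : g ≠ 0) :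
    f * g ≠ 0 := fun h => (eq_zero_or_eq_zero_of_mul h).elim hf hg

theorem mul_left_cancel_of_ne {𝕜 : Type*} [RCLike 𝕜] {a b c : CSpace 𝕜} (ha : a ≠ 0)
    (h : a * b = a * c) : b = c := by
  have : a * (b - c) = 0 := by rw [mul_sub, h, sub_self]
  exact sub_eq_zero.mp ((eq_zero_or_eq_zero_of_mul this).resolve_left ha)

/-- Pairs (numerator, nonzero denominator). -/
abbrev PreM (𝕜 : Type*) [RCLike 𝕜] := CSpace 𝕜 × {g : CSpace 𝕜 // g ≠ 0}

/-- `(f, g) ∼ (f₁, g₁)` if and only if `f * g₁ = g * f₁`. -/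
instance convSetoid (𝕜 : Type*) [RCLike 𝕜] : Setoid (PreM 𝕜) where
  r a b := a.1 * b.2.1 = a.2.1 * b.1
  iseqv :=
    { refl := fun a => mul_comm _ _
      symm := fun {a b} h => by
        rw [mul_comm b.1, mul_comm b.2.1]; exact h.symm
      trans := fun {a b c} h h' => by
        apply mul_left_cancel_of_ne b.2.2
        calc b.2.1 * (a.1 * c.2.1) = (a.1 * b.2.1) * c.2.1 := by rw [← mul_assoc, mul_comm b.2.1]
          _ = a.2.1 * (b.1 * c.2.1) := by rw [h, mul_assoc]
          _ = b.2.1 * (a.2.1 * c.1) := by rw [h', mul_left_comm] }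

/-- The field `M_{-1}` of convolution quotients. -/
def MField (𝕜 : Type*) [RCLike 𝕜] := Quotient (convSetoid 𝕜)

/-- The convolution quotient `f / g`. -/
def frac {𝕜 : Type*} [RCLike 𝕜] (f g : CSpace 𝕜) (hg : g ≠ 0) : MField 𝕜 :=
  Quotient.mk (convSetoid 𝕜) (f, ⟨g, hg⟩)

theorem frac_eq_frac {𝕜 : Type*} [RCLike 𝕜] {f g f₁ g₁ : CSpace 𝕜} {hg : g ≠ 0} {hg₁ : g₁ ≠ 0} :
    frac f g hg = frac f₁ g₁ hg₁ ↔ f * g₁ = g * f₁ := Quotient.eq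

theorem frac_induction {𝕜 : Type*} [RCLike 𝕜] {P : MField 𝕜 → Prop}
    (h : ∀ f g hg, P (frac f g hg)) (x : MField 𝕜) : P x :=
  Quotient.ind (fun a => h a.1 a.2.1 a.2.2) x

noncomputable instance {𝕜 : Type*} [RCLike 𝕜] : Add (MField 𝕜) :=
  ⟨Quotient.map₂ (fun a b => (a.1 * b.2.1 + a.2.1 * b.1, ⟨a.2.1 * b.2.1, mul_ne_zero_of_ne a.2.2 b.2.2⟩))
    (fun a a' h b b' h' => by
      change (a.1 * b.2.1 + a.2.1 * b.1) * (a'.2.1 * b'.2.1) =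
        (a.2.1 * b.2.1) * (a'.1 * b'.2.1 + a'.2.1 * b'.1)
      have e : a.1 * a'.2.1 = a.2.1 * a'.1 := h
      have e' : b.1 * b'.2.1 = b.2.1 * b'.1 := h'
      rw [add_mul, mul_mul_mul_comm, e, mul_mul_mul_comm a.2.1 b.1, e', mul_add,
        mul_mul_mul_comm a.2.1 a'.1, mul_mul_mul_comm a.2.1 a'.2.1])⟩

noncomputable instance {𝕜 : Type*} [RCLike 𝕜] : Mul (MField 𝕜) :=
  ⟨Quotient.map₂ (fun a b => (a.1 * b.1, ⟨a.2.1 * b.2.1, mul_ne_zero_of_ne a.2.2 b.2.2⟩))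
    (fun a a' h b b' h' => by
      change (a.1 * b.1) * (a'.2.1 * b'.2.1) = (a.2.1 * b.2.1) * (a'.1 * b'.1)
      have e : a.1 * a'.2.1 = a.2.1 * a'.1 := h
      have e' : b.1 * b'.2.1 = b.2.1 * b'.1 := h'
      rw [mul_mul_mul_comm, e, e', mul_mul_mul_comm])⟩

noncomputable instance {𝕜 : Type*} [RCLike 𝕜] : Neg (MField 𝕜) :=
  ⟨Quotient.map (fun a => (-a.1, a.2)) (fun a a' h => by
      change -a.1 * a'.2.1 = a.2.1 * -a'.1
      have e : a.1 * a'.2.1 = a.2.1 * a'.1 := h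
      rw [neg_mul, e, mul_neg])⟩

/-- Multiplication by scalars, `λ (f / g) = (λ f) / g`. -/
noncomputable instance {𝕜 : Type*} [RCLike 𝕜] : SMul 𝕜 (MField 𝕜) :=
  ⟨fun c => Quotient.map (fun a => (c • a.1, a.2)) (fun a a' h => by
      change (c • a.1) * a'.2.1 = a.2.1 * (c • a'.1)
      have e : a.1 * a'.2.1 = a.2.1 * a'.1 := h
      have h1 : ∀ u v : CSpace 𝕜, (c • u) * v = c • (u * v) := fun u v =>
        Subtype.ext (smul_conv c u.1 v.1)
      rw [h1, e, mul_comm a.2.1 (c • a'.1), h1, mul_comm a.2.1])⟩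

theorem frac_add_frac {𝕜 : Type*} [RCLike 𝕜] (f g f₁ g₁ : CSpace 𝕜) (hg : g ≠ 0) (hg₁ : g₁ ≠ 0) :
    frac f g hg + frac f₁ g₁ hg₁ = frac (f * g₁ + g * f₁) (g * g₁) (mul_ne_zero_of_ne hg hg₁) := rfl

theorem frac_mul_frac {𝕜 : Type*} [RCLike 𝕜] (f g f₁ g₁ : CSpace 𝕜) (hg : g ≠ 0) (hg₁ : g₁ ≠ 0) :
    frac f g hg * frac f₁ g₁ hg₁ = frac (f * f₁) (g * g₁) (mul_ne_zero_of_ne hg hg₁) := rfl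

theorem neg_frac {𝕜 : Type*} [RCLike 𝕜] (f g : CSpace 𝕜) (hg : g ≠ 0) :
    -frac f g hg = frac (-f) g hg := rfl

theorem smul_frac {𝕜 : Type*} [RCLike 𝕜] (c : 𝕜) (f g : CSpace 𝕜) (hg : g ≠ 0) :
    c • frac f g hg = frac (c • f) g hg := rfl

/-- The identity element `I = h_α / h_α` (here with `α = 1`). -/
noncomputable instance {𝕜 : Type*} [RCLike 𝕜] : One (MField 𝕜) :=
  ⟨frac (hker 1 one_pos) (hker 1 one_pos) (hker_ne_zero 1 one_pos)⟩

noncomputable instance {𝕜 : Type*} [RCLike 𝕜] : Zero (MField 𝕜) :=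
  ⟨frac 0 (hker 1 one_pos) (hker_ne_zero 1 one_pos)⟩

theorem one_def_frac {𝕜 : Type*} [RCLike 𝕜] : (1 : MField 𝕜) =
    frac (hker 1 one_pos) (hker 1 one_pos) (hker_ne_zero 1 one_pos) := rfl

theorem zero_def_frac {𝕜 : Type*} [RCLike 𝕜] : (0 : MField 𝕜) =
    frac 0 (hker 1 one_pos) (hker_ne_zero 1 one_pos) := rfl

theorem frac_eq_zero {𝕜 : Type*} [RCLike 𝕜] {f g : CSpace 𝕜} {hg : g ≠ 0} :
    frac f g hg = 0 ↔ f = 0 := by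
  rw [zero_def_frac, frac_eq_frac, mul_zero]
  exact ⟨fun h => (eq_zero_or_eq_zero_of_mul h).resolve_right (hker_ne_zero _ _),
    fun h => by rw [h, zero_mul]⟩

open Classical in
/-- The reciprocal `(f / g)⁻¹ = g / f` for `f ≠ 0`; `0⁻¹ = 0` by convention. -/
noncomputable instance {𝕜 : Type*} [RCLike 𝕜] : Inv (MField 𝕜) :=
  ⟨Quotient.lift (fun a => if h : a.1 = 0 then 0 else frac a.2.1 a.1 h) (fun a b h => by
    have e : a.1 * b.2.1 = a.2.1 * b.1 := h
    by_cases ha : a.1 = 0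
    · have hb : b.1 = 0 := by
        rw [ha, zero_mul] at e
        exact (eq_zero_or_eq_zero_of_mul e.symm).resolve_left a.2.2
      simp only [ha, hb, dite_true]
    · have hb : b.1 ≠ 0 := by
        intro hb
        rw [hb, mul_zero] at e
        exact (eq_zero_or_eq_zero_of_mul e).elim ha b.2.2
      simp only [ha, hb, dite_false]
      rw [frac_eq_frac]
      exact e.symm)⟩

theorem inv_frac {𝕜 : Type*} [RCLike 𝕜] (f g : CSpace 𝕜) (hg : g ≠ 0) (hf : f ≠ 0) :
    (frac f g hg)⁻¹ = frac g f hf := dif_neg hf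

noncomputable instance {𝕜 : Type*} [RCLike 𝕜] : Field (MField 𝕜) where
  add_assoc := by
    refine frac_induction fun a b hb => frac_induction fun c d hd => frac_induction fun e f hf => ?_
    simp only [frac_add_frac, frac_eq_frac]
    simp only [mul_add, mul_comm, mul_left_comm, add_assoc]
  zero_add := by
    refine frac_induction fun a b hb => ?_
    simp only [zero_def_frac, frac_add_frac, frac_eq_frac]
    simp only [zero_mul, zero_add, mul_assoc]
    rw [mul_comm a]
  add_zero := by
    refine frac_induction fun a b hb => ?_
    simp only [zero_def_frac, frac_add_frac, frac_eq_frac]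
    simp only [mul_zero, add_zero, mul_comm, mul_left_comm]
  add_comm := by
    refine frac_induction fun a b hb => frac_induction fun c d hd => ?_
    simp only [frac_add_frac, frac_eq_frac]
    simp only [mul_add, mul_comm, mul_left_comm, add_comm]
  nsmul := nsmulRec
  zsmul := zsmulRec
  neg_add_cancel := by
    refine frac_induction fun a b hb => ?_
    simp only [zero_def_frac, neg_frac, frac_add_frac, frac_eq_frac]
    rw [neg_mul, mul_comm b a, neg_add_cancel, zero_mul, mul_zero]
  mul_assoc := by
    refine frac_induction fun a b hb => frac_induction fun c d hd => frac_induction fun e f hf => ?_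
    simp only [frac_mul_frac, mul_assoc]
  mul_comm := by
    refine frac_induction fun a b hb => frac_induction fun c d hd => ?_
    simp only [frac_mul_frac, frac_eq_frac]
    simp only [mul_comm, mul_left_comm]
  one_mul := by
    refine frac_induction fun a b hb => ?_
    simp only [one_def_frac, frac_mul_frac, frac_eq_frac]
    simp only [mul_comm, mul_left_comm]
  mul_one := by
    refine frac_induction fun a b hb => ?_
    simp only [one_def_frac, frac_mul_frac, frac_eq_frac]
    simp only [mul_comm, mul_left_comm]
  zero_mul := by
    refine frac_induction fun a b hb => ?_
    simp only [zero_def_frac, frac_mul_frac, frac_eq_frac]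
    simp only [zero_mul, mul_zero]
  mul_zero := by
    refine frac_induction fun a b hb => ?_
    simp only [zero_def_frac, frac_mul_frac, frac_eq_frac]
    simp only [zero_mul, mul_zero]
  left_distrib := by
    refine frac_induction fun a b hb => frac_induction fun c d hd => frac_induction fun e f hf => ?_
    simp only [frac_add_frac, frac_mul_frac, frac_eq_frac]
    simp only [mul_add, mul_comm, mul_left_comm]
  right_distrib := by
    refine frac_induction fun a b hb => frac_induction fun c d hd => frac_induction fun e f hf => ?_
    simp only [frac_add_frac, frac_mul_frac, frac_eq_frac]
    simp only [mul_add, mul_comm, mul_left_comm]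
  exists_pair_ne := ⟨1, 0, fun h => hker_ne_zero 1 one_pos (frac_eq_zero.mp h)⟩
  mul_inv_cancel := by
    refine frac_induction fun a b hb => ?_
    intro h
    have ha : a ≠ 0 := fun ha => h (frac_eq_zero.mpr ha)
    rw [inv_frac a b hb ha, frac_mul_frac, one_def_frac, frac_eq_frac, mul_comm a b]
  inv_zero := dif_pos rfl
  nnqsmul := _
  nnqsmul_def := fun _ _ => rfl
  qsmul := _
  qsmul_def := fun _ _ => rfl

/-- The embedding `f ↦ (h_α * f) / h_α` of the ring `C_{-1}` into the field `M_{-1}` (the class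
does not depend on `α > 0`; here `α = 1`). -/
noncomputable def emb {𝕜 : Type*} [RCLike 𝕜] (f : CSpace 𝕜) : MField 𝕜 :=
  frac (hker 1 one_pos * f) (hker 1 one_pos) (hker_ne_zero 1 one_pos)

/-- The elements `S_β` of `M_{-1}`: for `β > 0`, the reciprocal of `h_β`, i.e. the algebraic inverse
of the Riemann-Liouville integral of order `β`; `S_0 = I`, and `S_{-β} = h_β` for `β > 0`. -/
noncomputable def S (𝕜 : Type*) [RCLike 𝕜] (β : ℝ) : MField 𝕜 :=
  if hβ : 0 < β then (emb (hker β hβ))⁻¹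
  else if hβ' : β < 0 then emb (hker (-β) (neg_pos.mpr hβ'))
  else 1

/-- The Riemann-Liouville integral of order `a ≥ 0`, with `J^0` the identity. -/
noncomputable def J {𝕜 : Type*} [RCLike 𝕜] (a : ℝ) (f : ℝ → 𝕜) (x : ℝ) : 𝕜 :=
  if a = 0 then f x
  else ((1 / Real.Gamma a : ℝ) : 𝕜) * ∫ τ in (0 : ℝ)..x, f τ / (((x - τ) ^ (1 - a) : ℝ) : 𝕜)

/-- The Riemann-Liouville derivative `d/dx J^{1-a}` of order `a ∈ (0, 1]`. -/
noncomputable def rlDeriv {𝕜 : Type*} [RCLike 𝕜] (a : ℝ) (f : ℝ → 𝕜) : ℝ → 𝕜 :=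
  deriv (J (1 - a) f)

/-- The sequential derivative `D^{α_{k-1}} ⋯ D^{α_1} D^{α_0} f`. -/
noncomputable def seqDeriv {𝕜 : Type*} [RCLike 𝕜] (α : ℕ → ℝ) (f : ℝ → 𝕜) : ℕ → ℝ → 𝕜
  | 0 => f
  | k + 1 => rlDeriv (α k) (seqDeriv α f k)

/-- The order `ϱ_k = α_0 + ⋯ + α_k - 1`. -/
noncomputable def rho (α : ℕ → ℝ) (k : ℕ) : ℝ := ∑ j ∈ Finset.range (k + 1), α j - 1

/-- The Dzherbashian-Nersesian operator
`𝒟^{ϱ_k} = J^{1-α_k} D^{α_{k-1}} ⋯ D^{α_1} D^{α_0}` of order `ϱ_k`; in particular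
`𝒟^{ϱ_0} = J^{1-α_0}`. -/
noncomputable def dnOp {𝕜 : Type*} [RCLike 𝕜] (α : ℕ → ℝ) (k : ℕ) (f : ℝ → 𝕜) : ℝ → 𝕜 :=
  J (1 - α k) (seqDeriv α f k)

/-- The space `Ω^{ϱ_m}_{-1}`: functions of class `C_{-1}` whose sequential derivatives
`D^{α_k} ⋯ D^{α_0} y = d/dx 𝒟^{ϱ_k} y`, `k = 0, …, m - 1`, all exist on `(0, ∞)` and are of class
`C_{-1}`. -/
structure MemOmega {𝕜 : Type*} [RCLike 𝕜] (α : ℕ → ℝ) (m : ℕ) (y : ℝ → 𝕜) : Prop where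
  memC : MemC (-1) y
  differentiable : ∀ k < m, ∀ x, 0 < x → DifferentiableAt ℝ (dnOp α k y) x
  memC_deriv : ∀ k < m, MemC (-1) (seqDeriv α y (k + 1))

end MikusinskiDN

open MikusinskiDN

namespace MikusinskiDN

/-! In the field of convolution quotients, fractional integration and differentiation become
algebra. Since `J a f` is the convolution of `f` with `h_a`, the operator $J^a$ acts as
multiplication by $S_{-a}$ (`emb_toC_J`). If $u'$ lies in $C_{-1}$, it is integrable near $0$, so
$u=h_1*u'+u(0+)h_1$ on $(0,\infty)$, where $h_1$ is the constant $1$. Multiplying by $S_1$ gives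
$u'=S_1\circ u-u(0+)S_0$ (`exists_tendsto_and_emb_deriv`). The same decomposition produces the limit
at $0+$.

The Beta integral gives $h_a*h_b=h_{a+b}$ (`hker_mul_hker`), and the absence of zero divisors makes
each $h_a$ invertible, so $S_aS_b=S_{a+b}$ for all real $a,b$ (`S_mul_S`). Hence
$D^{\alpha_k}=\frac{d}{dx}J^{1-\alpha_k}$ acts as $z\mapsto S_{\alpha_k}\circ z-c_kS_0$, where
$c_k=(\mathcal D^{\varrho_k}y)(0)$ (`MemOmega.exists_tendsto`).

Iterating this affine recursion (`MemOmega.emb_seqDeriv`), $y$ acquires the factor $S_{\sigma_m}$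
with $\sigma_m=\alpha_0+\dots+\alpha_{m-1}$. The constant $c_i$, born at step $i$, is multiplied
only by the later factors, whose orders add up to $\sigma_m-\varrho_i-1$. The outer $J^{1-\alpha_m}$
contributes $S_{\alpha_m-1}$, which turns $\sigma_m$ into $\varrho_m$ everywhere. -/

/-! ### Functions of class $C_{-1}$ on the open half-line. -/

theorem toC_apply {𝕜 : Type*} [RCLike 𝕜] {f : ℝ → 𝕜} (hf : MemC (-1) f) {x : ℝ} (hx : 0 < x) :
    (toC f hf).1 x = f x :=
  indicator_of_mem (mem_Ioi.mpr hx) f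

theorem CSpace_ext {𝕜 : Type*} [RCLike 𝕜] {f g : CSpace 𝕜} (h : ∀ x, 0 < x → f.1 x = g.1 x) :
    f = g := by
  apply Subtype.ext
  funext x
  rcases le_or_gt x 0 with hx | hx
  · rw [f.2.2 x hx, g.2.2 x hx]
  · exact h x hx

/-- Lets the values of `J` outside $(0,\infty)$ be ignored. -/
theorem MemC.congr {𝕜 : Type*} [RCLike 𝕜] {γ : ℝ} {f g : ℝ → 𝕜} (hf : MemC γ f)
    (h : ∀ x, 0 < x → g x = f x) : MemC γ g := by
  obtain ⟨p, hp, f₁, hf₁, e⟩ := hf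
  exact ⟨p, hp, f₁, hf₁, fun x hx => (h x hx).trans (e x hx)⟩

theorem MemC.continuousAt {𝕜 : Type*} [RCLike 𝕜] {γ : ℝ} {f : ℝ → 𝕜} (hf : MemC γ f) {x : ℝ}
    (hx : 0 < x) : ContinuousAt f x := by
  obtain ⟨p, -, g, hg, e⟩ := hf.exists_continuous
  have : ContinuousAt (fun x => ((x ^ p : ℝ) : 𝕜) * g x) x :=
    (RCLike.continuous_ofReal.continuousAt.comp
      (Real.continuousAt_rpow_const x p (Or.inl hx.ne'))).mul hg.continuousAt
  refine this.congr ?_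
  filter_upwards [Ioi_mem_nhds hx] with y hy
  exact (e y hy).symm

/-! ### The Beta integral and the semigroup of kernels $h_a$. -/

/-- Scaling to $[0,1]$ turns the integral into $x^{a+b-1}B(b,a)$, and
$B(b,a)=\Gamma(a)\Gamma(b)/\Gamma(a+b)$. The computation passes through the complex Beta integral.
-/
theorem integral_rpow_mul_rpow {a b x : ℝ} (ha : 0 < a) (hb : 0 < b) (hx : 0 < x) :
    ∫ t in (0 : ℝ)..x, ((x - t) ^ (a - 1) / Real.Gamma a) * (t ^ (b - 1) / Real.Gamma b) =
      x ^ (a + b - 1) / Real.Gamma (a + b) := by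
  have hΓa := (Real.Gamma_pos_of_pos ha).ne'
  have hΓb := (Real.Gamma_pos_of_pos hb).ne'
  have hΓab := (Real.Gamma_pos_of_pos (add_pos ha hb)).ne'
  have hB := Complex.Gamma_mul_Gamma_eq_betaIntegral (s := (b : ℂ)) (t := (a : ℂ))
    (by simpa using hb) (by simpa using ha)
  have key : ∫ t in (0 : ℝ)..x, t ^ (b - 1) * (x - t) ^ (a - 1) =
      x ^ (a + b - 1) * (Real.Gamma a * Real.Gamma b / Real.Gamma (a + b)) := by
    apply Complex.ofReal_injective
    rw [← intervalIntegral.integral_ofReal]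
    have hs := Complex.betaIntegral_scaled (b : ℂ) (a : ℂ) hx
    have h1 : ∫ t in (0 : ℝ)..x, ((t ^ (b - 1) * (x - t) ^ (a - 1) : ℝ) : ℂ) =
        ∫ t in (0 : ℝ)..x, (t : ℂ) ^ ((b : ℂ) - 1) * ((x : ℂ) - t) ^ ((a : ℂ) - 1) := by
      -- Real and complex powers are matched for nonnegative bases, hence the use of $0\le t\le x$.
      refine intervalIntegral.integral_congr fun t ht => ?_
      rw [uIcc_of_le hx.le] at ht
      rw [Complex.ofReal_mul, Complex.ofReal_cpow ht.1, Complex.ofReal_cpow (sub_nonneg.mpr ht.2)]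
      push_cast
      rfl
    rw [h1, hs, Complex.ofReal_mul, Complex.ofReal_cpow hx.le]
    have hBval : Complex.betaIntegral b a =
        ((Real.Gamma a * Real.Gamma b / Real.Gamma (a + b) : ℝ) : ℂ) := by
      rw [Complex.ofReal_div, eq_div_iff (Complex.ofReal_ne_zero.mpr hΓab)]
      rw [Complex.Gamma_ofReal, Complex.Gamma_ofReal, ← Complex.ofReal_add,
        Complex.Gamma_ofReal] at hB
      rw [Complex.ofReal_mul, mul_comm (Real.Gamma a : ℂ), hB, mul_comm, add_comm b a]
    rw [hBval]
    push_cast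
    ring_nf
  have h2 : ∀ t : ℝ, ((x - t) ^ (a - 1) / Real.Gamma a) * (t ^ (b - 1) / Real.Gamma b) =
      (1 / (Real.Gamma a * Real.Gamma b)) * (t ^ (b - 1) * (x - t) ^ (a - 1)) := fun t => by
    field_simp
  simp only [h2]
  rw [intervalIntegral.integral_const_mul, key]
  field_simp

theorem hker_apply {𝕜 : Type*} [RCLike 𝕜] {a : ℝ} (ha : 0 < a) {x : ℝ} (hx : 0 < x) :
    (hker a ha : CSpace 𝕜).1 x = ((x ^ (a - 1) / Real.Gamma a : ℝ) : 𝕜) :=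
  toC_apply _ hx

/-- Discards the endpoint $t=x$, where the kernel is evaluated at $0$: there `hker` vanishes by
normalisation, while the power formula need not (for instance when $a=1$). -/
theorem ae_mem_uIoc_lt (x : ℝ) (hx : 0 < x) :
    ∀ᵐ t : ℝ, t ∈ uIoc (0 : ℝ) x → 0 < t ∧ t < x := by
  have h1 : ∀ᵐ s : ℝ, s ≠ x := by simp [ae_iff, measure_singleton]
  filter_upwards [h1] with s hs1 hs
  rw [uIoc_of_le hx.le] at hs
  exact ⟨hs.1, lt_of_le_of_ne hs.2 hs1⟩

/-- The semigroup property `h_a * h_b = h_{a+b}`. -/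
theorem hker_mul_hker {𝕜 : Type*} [RCLike 𝕜] {a b : ℝ} (ha : 0 < a) (hb : 0 < b) :
    (hker a ha * hker b hb : CSpace 𝕜) = hker (a + b) (add_pos ha hb) := by
  refine CSpace_ext fun x hx => ?_
  rw [hker_apply _ hx, ← integral_rpow_mul_rpow ha hb hx, coe_mul_conv, conv,
    ← RCLike.intervalIntegral_ofReal]
  refine intervalIntegral.integral_congr_ae ?_
  filter_upwards [ae_mem_uIoc_lt x hx] with t ht ht'
  obtain ⟨h0, h1⟩ := ht ht'
  rw [hker_apply ha (sub_pos.mpr h1), hker_apply hb h0, RCLike.ofReal_mul]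

/-! ### Algebra of the embedding into $M_{-1}$. -/

theorem smul_mul_CSpace {𝕜 : Type*} [RCLike 𝕜] (c : 𝕜) (f g : CSpace 𝕜) :
    (c • f) * g = c • (f * g) :=
  Subtype.ext (smul_conv c f.1 g.1)

theorem emb_mul {𝕜 : Type*} [RCLike 𝕜] (f g : CSpace 𝕜) : emb (f * g) = emb f * emb g := by
  simp only [emb, frac_mul_frac, frac_eq_frac]
  simp only [mul_comm, mul_left_comm]

theorem emb_add {𝕜 : Type*} [RCLike 𝕜] (f g : CSpace 𝕜) : emb (f + g) = emb f + emb g := by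
  simp only [emb, frac_add_frac, frac_eq_frac]
  simp only [mul_add, mul_comm, mul_left_comm]

theorem emb_smul {𝕜 : Type*} [RCLike 𝕜] (c : 𝕜) (f : CSpace 𝕜) : emb (c • f) = c • emb f := by
  simp only [emb, smul_frac]
  congr 1
  rw [mul_comm, smul_mul_CSpace, mul_comm]

/-- A consequence of the absence of zero divisors; it allows cancelling the embedded kernels. -/
theorem emb_ne_zero {𝕜 : Type*} [RCLike 𝕜] {f : CSpace 𝕜} (hf : f ≠ 0) : emb f ≠ 0 :=
  fun h => mul_ne_zero_of_ne (hker_ne_zero 1 one_pos) hf (frac_eq_zero.mp h)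

theorem smul_mul_MField {𝕜 : Type*} [RCLike 𝕜] (c : 𝕜) (u v : MField 𝕜) :
    (c • u) * v = c • (u * v) := by
  revert u v
  refine frac_induction fun a b hb => frac_induction fun d e he => ?_
  rw [smul_frac, frac_mul_frac, frac_mul_frac, smul_frac, smul_mul_CSpace]

theorem mul_smul_MField {𝕜 : Type*} [RCLike 𝕜] (c : 𝕜) (u v : MField 𝕜) :
    u * (c • v) = c • (u * v) := by
  rw [mul_comm, smul_mul_MField, mul_comm]

/-! ### The group of elements $S_\beta$. -/

theorem S_neg {𝕜 : Type*} [RCLike 𝕜] {a : ℝ} (ha : 0 < a) : S 𝕜 (-a) = emb (hker a ha) := by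
  have h1 : ¬ 0 < -a := by linarith
  have h2 : -a < 0 := by linarith
  simp only [S, h1, h2, dite_true, dite_false, neg_neg]

theorem S_zero {𝕜 : Type*} [RCLike 𝕜] : S 𝕜 0 = 1 := by
  simp [S]

/-- A single formula absorbing the three cases in the definition of `S`. For $\beta<0$ it is the
semigroup property, for $\beta=0$ it is trivial, and for $\beta>0$ one factors
$h_c=h_\beta*h_{c-\beta}$ and cancels $h_\beta$. -/
theorem S_mul_emb_hker {𝕜 : Type*} [RCLike 𝕜] {β c : ℝ} (hc : 0 < c) (h : β < c) :
    S 𝕜 β * emb (hker c hc) = emb (hker (c - β) (sub_pos.mpr h)) := by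
  rcases lt_trichotomy β 0 with hβ | rfl | hβ
  · obtain ⟨a, rfl⟩ : ∃ a, β = -a := ⟨-β, by simp⟩
    have ha : 0 < a := by linarith
    rw [S_neg ha, ← emb_mul, hker_mul_hker]
    simp only [sub_neg_eq_add, add_comm]
  · simp only [S_zero, one_mul, sub_zero]
  · have e : (hker c hc : CSpace 𝕜) = hker β hβ * hker (c - β) (sub_pos.mpr h) := by
      rw [hker_mul_hker]
      simp only [add_sub_cancel]
    rw [S, dif_pos hβ, e, emb_mul, inv_mul_cancel_left₀ (emb_ne_zero (hker_ne_zero β hβ))]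

/-- The elements `S_β` form a one-parameter group. -/
theorem S_mul_S {𝕜 : Type*} [RCLike 𝕜] (a b : ℝ) : S 𝕜 a * S 𝕜 b = S 𝕜 (a + b) := by
  -- The orders $|a|+1$ and $|b|+1$ are positive and exceed $a$ and $b$. Multiplying both sides by
  -- the product of these two kernels turns them into kernels of positive order, whatever the signs
  -- of $a$ and $b$; the nonzero factor is then cancelled.
  have ha : 0 < |a| + 1 := by positivity
  have hb : 0 < |b| + 1 := by positivity
  have ha' : a < |a| + 1 := by linarith [le_abs_self a]
  have hb' : b < |b| + 1 := by linarith [le_abs_self b]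
  have hne := emb_ne_zero (hker_ne_zero (𝕜 := 𝕜) _ (add_pos ha hb))
  apply mul_right_cancel₀ hne
  rw [S_mul_emb_hker (add_pos ha hb) (by linarith), ← hker_mul_hker ha hb, emb_mul,
    mul_mul_mul_comm, S_mul_emb_hker ha ha', S_mul_emb_hker hb hb', ← emb_mul, hker_mul_hker]
  congr 2
  ring

/-! ### Riemann-Liouville integrals and derivatives as elements of $M_{-1}$. -/

/-- The integrands agree for $0<t<x$, since dividing by $(x-t)^{1-a}$ is multiplying by
$(x-t)^{a-1}$. -/
theorem J_eq_hker_mul {𝕜 : Type*} [RCLike 𝕜] {a : ℝ} (ha : 0 < a) {f : ℝ → 𝕜}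
    (hf : MemC (-1) f) {x : ℝ} (hx : 0 < x) : J a f x = (hker a ha * toC f hf).1 x := by
  rw [J, if_neg ha.ne', coe_mul_conv, conv, ← intervalIntegral.integral_const_mul]
  refine intervalIntegral.integral_congr_ae ?_
  filter_upwards [ae_mem_uIoc_lt x hx] with t ht ht'
  obtain ⟨h0, h1⟩ := ht ht'
  have h2 := sub_pos.mpr h1
  rw [hker_apply ha h2, toC_apply hf h0, show a - 1 = -(1 - a) by ring, Real.rpow_neg h2.le]
  push_cast
  ring

/-- For $a>0$ this is closure of $C_{-1}$ under convolution. The order $a=0$, needed when some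
$\alpha_k=1$, is separate because there is no kernel $h_0$. -/
theorem MemC.J {𝕜 : Type*} [RCLike 𝕜] {a : ℝ} (ha : 0 ≤ a) {f : ℝ → 𝕜} (hf : MemC (-1) f) :
    MemC (-1) (J a f) := by
  rcases ha.eq_or_lt with rfl | ha
  · exact hf.congr fun x _ => if_pos rfl
  · exact (hker a ha * toC f hf).2.1.congr fun x hx => J_eq_hker_mul ha hf hx

theorem emb_toC_J {𝕜 : Type*} [RCLike 𝕜] {a : ℝ} (ha : 0 ≤ a) {f : ℝ → 𝕜} (hf : MemC (-1) f)
    (hJ : MemC (-1) (MikusinskiDN.J a f)) :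
    emb (toC (MikusinskiDN.J a f) hJ) = S 𝕜 (-a) * emb (toC f hf) := by
  rcases ha.eq_or_lt with rfl | ha
  · rw [neg_zero, S_zero, one_mul]
    congr 1
    refine CSpace_ext fun x hx => ?_
    rw [toC_apply hJ hx, toC_apply hf hx]
    exact if_pos rfl
  · rw [S_neg ha, ← emb_mul]
    congr 1
    refine CSpace_ext fun x hx => ?_
    rw [toC_apply hJ hx, J_eq_hker_mul ha hf hx]

/-- If `u` is differentiable on `(0, ∞)` with derivative of class `C_{-1}`, then `u` has a limit at
`0+`, and `u' = S_1 ∘ u - u(0)` in `M_{-1}`. -/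
theorem exists_tendsto_and_emb_deriv {𝕜 : Type*} [RCLike 𝕜] {u : ℝ → 𝕜} (hu : MemC (-1) u)
    (hd : ∀ x, 0 < x → DifferentiableAt ℝ u x) (hu' : MemC (-1) (deriv u)) :
    ∃ c : 𝕜, Tendsto u (𝓝[>] 0) (𝓝 c) ∧
      emb (toC (deriv u) hu') = S 𝕜 1 * emb (toC u hu) - c • 1 := by
  set v := toC (deriv u) hu' with hv
  -- `F` is the primitive $\int_0^x u'$. It is continuous up to $0$ with $F(0)=0$, although $u'$ may
  -- be unbounded there.
  set F : ℝ → 𝕜 := (hker 1 one_pos * v : CSpace 𝕜).1 with hF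
  have hFc : Continuous F := continuous_hker_one_mul v
  have hF0 : F 0 = 0 := (hker 1 one_pos * v : CSpace 𝕜).2.2 0 le_rfl
  have hFd : ∀ x, 0 < x → HasDerivAt F (deriv u x) x := by
    intro x hx
    have hvx : v.1 x = deriv u x := toC_apply hu' hx
    rw [show F = fun x => ∫ t in (0 : ℝ)..x, v.1 t from funext (hker_one_mul v), ← hvx]
    exact intervalIntegral.integral_hasDerivAt_right (intervalIntegrable_of_mem v.2 0 x)
      ⟨univ, univ_mem, (aesm v.2).restrict⟩ (v.2.1.continuousAt hx)
  -- On the connected set $(0,\infty)$ the functions `u` and `F` have the same derivative. Their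
  -- constant difference is the limit of `u` at $0+$, because `F` tends to $0$.
  obtain ⟨c, hc⟩ := isOpen_Ioi.exists_eq_add_of_deriv_eq (s := Ioi (0 : ℝ)) (f := u) (g := F)
    isPreconnected_Ioi (fun x hx => (hd x hx).differentiableWithinAt)
    (fun x hx => (hFd x hx).differentiableAt.differentiableWithinAt)
    (fun x hx => (hFd x hx).deriv.symm)
  refine ⟨c, ?_, ?_⟩
  · have h1 : Tendsto (fun x => F x + c) (𝓝[>] 0) (𝓝 c) := by
      have := (hFc.tendsto 0).add_const c
      rw [hF0, zero_add] at this
      exact this.mono_left nhdsWithin_le_nhds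
    refine h1.congr' ?_
    filter_upwards [self_mem_nhdsWithin] with x hx
    exact (hc hx).symm
  · have hsplit : toC u hu = hker 1 one_pos * v + c • hker 1 one_pos := by
      refine CSpace_ext fun x hx => ?_
      rw [toC_apply hu hx, hc hx]
      change F x + c = F x + c * (hker 1 one_pos : CSpace 𝕜).1 x
      rw [hker_apply one_pos hx]
      simp
    have h1 : S 𝕜 1 * S 𝕜 (-1) = 1 := by rw [S_mul_S, add_neg_cancel, S_zero]
    rw [hsplit, emb_add, emb_mul, emb_smul, ← S_neg, mul_add, ← mul_assoc, h1, one_mul,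
      mul_smul_MField, h1, add_sub_cancel_right]

/-! ### The recursion for sequential derivatives and its solution. -/

theorem rho_eq (α : ℕ → ℝ) (k : ℕ) : rho α k = ∑ j ∈ Finset.range k, α j + α k - 1 := by
  rw [rho, Finset.sum_range_succ]

theorem MemOmega.memC_seqDeriv {𝕜 : Type*} [RCLike 𝕜] {α : ℕ → ℝ} {m : ℕ} {y : ℝ → 𝕜}
    (hy : MemOmega α m y) {k : ℕ} (hk : k ≤ m) : MemC (-1) (seqDeriv α y k) := by
  cases k with
  | zero => exact hy.memC
  | succ k => exact hy.memC_deriv k hk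

/-- One step of the recursion: integration of order $1-\alpha_k$ followed by differentiation gives
the factor $S_1S_{\alpha_k-1}=S_{\alpha_k}$, and the derivative contributes the limit of `dnOp α k
y` at $0+$. -/
theorem MemOmega.exists_tendsto {𝕜 : Type*} [RCLike 𝕜] {α : ℕ → ℝ} {m : ℕ}
    (hα : ∀ j ≤ m, 0 < α j ∧ α j ≤ 1) {y : ℝ → 𝕜} (hy : MemOmega α m y) {k : ℕ} (hk : k < m) :
    ∃ c : 𝕜, Tendsto (dnOp α k y) (𝓝[>] 0) (𝓝 c) ∧
      emb (toC (seqDeriv α y (k + 1)) (hy.memC_seqDeriv hk)) =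
        S 𝕜 (α k) * emb (toC (seqDeriv α y k) (hy.memC_seqDeriv hk.le)) - c • 1 := by
  have h1 : 0 ≤ 1 - α k := by linarith [(hα k hk.le).2]
  have hJ := (hy.memC_seqDeriv hk.le).J h1
  -- By definition `seqDeriv α y (k + 1)` unfolds to the derivative of `dnOp α k y`.
  obtain ⟨c, hc, he⟩ := exists_tendsto_and_emb_deriv (u := dnOp α k y) hJ (hy.differentiable k hk)
    (hy.memC_deriv k hk)
  refine ⟨c, hc, he.trans ?_⟩
  have := emb_toC_J h1 (hy.memC_seqDeriv hk.le) hJ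
  simp only [dnOp]
  rw [this, ← mul_assoc, S_mul_S]
  congr 3
  ring

/-- The sequential derivatives in `M_{-1}`. -/
theorem MemOmega.emb_seqDeriv {𝕜 : Type*} [RCLike 𝕜] {α : ℕ → ℝ} {m : ℕ} {y : ℝ → 𝕜}
    (hy : MemOmega α m y) {c : ℕ → 𝕜}
    (hc : ∀ k (hk : k < m), emb (toC (seqDeriv α y (k + 1)) (hy.memC_seqDeriv hk)) =
      S 𝕜 (α k) * emb (toC (seqDeriv α y k) (hy.memC_seqDeriv hk.le)) - c k • 1)
    (k : ℕ) (hk : k ≤ m) : emb (toC (seqDeriv α y k) (hy.memC_seqDeriv hk)) =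
      S 𝕜 (∑ j ∈ Finset.range k, α j) * emb (toC y hy.memC) -
        ∑ i ∈ Finset.range k, c i • S 𝕜 (∑ j ∈ Finset.range k, α j - rho α i - 1) := by
  induction k with
  | zero =>
    simp only [Finset.range_zero, Finset.sum_empty, S_zero, one_mul, sub_zero]
    rfl
  | succ k ih =>
    rw [hc k hk, ih (Nat.le_of_succ_le hk), mul_sub, ← mul_assoc, S_mul_S, Finset.mul_sum,
      Finset.sum_range_succ _ k, Finset.sum_range_succ _ k, rho_eq α k, ← sub_sub]
    congr 1
    · congr 1
      · rw [add_comm]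
      -- Each earlier constant picks up the factor $S_{\alpha_k}$, which raises its exponent by
      -- $\alpha_k$.
      · refine Finset.sum_congr rfl fun i _ => ?_
        rw [mul_smul_MField, S_mul_S]
        congr 2
        ring
    -- The newest constant has exponent $\sum_{j\le k}\alpha_j-\varrho_k-1=0$, so it multiplies the
    -- unit.
    · rw [← S_zero]
      congr 2
      ring

end MikusinskiDN

theorem theorem3p5 {𝕜 : Type*} [RCLike 𝕜] (m : ℕ) (hm : 1 ≤ m) (α : ℕ → ℝ)
    (hα : ∀ j ≤ m, 0 < α j ∧ α j ≤ 1) (hρ : 0 < rho α m)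
    (y : ℝ → 𝕜) (hy : MemOmega α m y) :
    ∃ (hD : MemC (-1) (dnOp α m y)) (c : ℕ → 𝕜),
      (∀ k < m, Filter.Tendsto (dnOp α k y) (nhdsWithin 0 (Set.Ioi 0)) (nhds (c k))) ∧
      emb (toC (dnOp α m y) hD) =
        S 𝕜 (rho α m) * emb (toC y hy.memC)
          - ∑ k ∈ Finset.range m, c k • S 𝕜 (rho α m - rho α k - 1) := by
  have h1 : 0 ≤ 1 - α m := by linarith [(hα m le_rfl).2]
  have hJ := (hy.memC_seqDeriv le_rfl).J h1
  -- The bound `k < m` is placed after the existential so that `choose` yields a plain sequence; its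
  -- values at $k\ge m$ are irrelevant and may be taken to be $0$.
  have hlim : ∀ k, ∃ c : 𝕜, ∀ hk : k < m, Tendsto (dnOp α k y) (𝓝[>] 0) (𝓝 c) ∧
      emb (toC (seqDeriv α y (k + 1)) (hy.memC_seqDeriv hk)) =
        S 𝕜 (α k) * emb (toC (seqDeriv α y k) (hy.memC_seqDeriv hk.le)) - c • 1 := fun k => by
    by_cases hk : k < m
    · obtain ⟨c, hc⟩ := hy.exists_tendsto hα hk
      exact ⟨c, fun _ => hc⟩
    · exact ⟨0, fun h => absurd h hk⟩
  choose c hc using hlim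
  refine ⟨hJ, c, fun k hk => (hc k hk).1, ?_⟩
  -- The outermost operator is an integral with no derivative, so no constant $c_m$ arises. Its
  -- factor $S_{-(1-\alpha_m)}$ shifts every exponent by $\alpha_m-1$, that is, from
  -- $\sum_{j<m}\alpha_j$ to $\varrho_m$.
  have he := emb_toC_J h1 (hy.memC_seqDeriv le_rfl) hJ
  refine he.trans ?_
  rw [hy.emb_seqDeriv (fun k hk => (hc k hk).2) m le_rfl, mul_sub, ← mul_assoc, S_mul_S,
    Finset.mul_sum, rho_eq α m]
  congr 1
  · congr 2
    ring
  · refine Finset.sum_congr rfl fun i _ => ?_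
    rw [mul_smul_MField, S_mul_S]
    congr 2
    ring
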